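/- For graphs $H$ and $G$, let $\mathcal N(H,G)$ be the number of (not necessarily induced, unlabelled) copies of $H$ in $G$, that is, of subgraphs of $G$ isomorphic to $H$. For a graph $F$, let $\mathrm{ex}(n,H,F)$ be the maximum of $\mathcal N(H,G)$ over all $F$-free graphs $G$ on $n$ vertices, where $F$-free means that $G$ has no (not necessarily induced) subgraph isomorphic to $F$. Let $T_r(n)$ be the complete $r$-partite graph on $n$ vertices all of whose parts have size $\lfloor n/r\rfloor$ or $\lceil n/r\rceil$, and let $P_3$ be the path on three vertices. An edge of a graph is called color-critical if deleting it decreases the chromatic number of the graph. If $F$ is a $k$-chromatic graph with $k\ge 2$ that is not contained in $H$, then $H$ is called $F$-Turán-good if $\mathrm{ex}(n,H,F)=\mathcal N(H,T_{k-1}(n))$ for every sufficiently large $n$. **Theorem.** Let $F$ be a finite graph with chromatic number $3$ that has a color-critical edge. Then $P_3$ is $F$-Turán-good. That is, $P_3$ does not contain $F$, and there is $n_0$ (depending on $F$) such that $\mathrm{ex}(n,P_3,F)=\mathcal N(P_3,T_2(n))$ for all $n\ge n_0$. -/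

import Mathlib

open Filter

namespace SimpleGraph

/-- An edge `e` of `G` is color-critical if deleting it decreases the chromatic number. -/
def IsColorCriticalEdge {V : Type*} (G : SimpleGraph V) (e : Sym2 V) : Prop :=
  e ∈ G.edgeSet ∧ (G.deleteEdges {e}).chromaticNumber < G.chromaticNumber

open scoped Classical in
/-- The generalized Turán number: the largest number of (unlabelled, not necessarily induced)
copies of `H` in an `F`-free graph on `n` vertices (`0` if there is no `F`-free graph on `n`
vertices). -/
noncomputable def genExtremalNumber (n : ℕ) {W V : Type*} (H : SimpleGraph W)
    (F : SimpleGraph V) : ℕ :=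
  (Finset.univ.filter fun G : SimpleGraph (Fin n) => F.Free G).sup fun G => G.copyCount H

/-- `H` is `F`-Turán-good, for an `(r + 1)`-chromatic graph `F` not contained in `H`: for all large
`n`, the generalized Turán number equals the number of copies of `H` in the `r`-partite Turán graph
on `n` vertices. -/
def IsTuranGood {W V : Type*} (H : SimpleGraph W) (F : SimpleGraph V) : Prop :=
  F.Free H ∧ ∃ r : ℕ, 0 < r ∧ F.chromaticNumber = ((r + 1 : ℕ) : ℕ∞) ∧
    ∀ᶠ n : ℕ in atTop, genExtremalNumber n H F = (turanGraph n r).copyCount H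

end SimpleGraph

/-! Let t = |V(F)|; paths on three vertices (cherries) are counted twice each. Deleting a
color-critical edge leaves F bipartite, so F embeds in a large complete bipartite graph plus one
edge inside a part.

In an F-free graph on n vertices where every vertex lies in about as many cherries as in `T_2(n)`,
all degrees are at least n/4, and an edge with 8t common neighbours would produce F by pigeonhole.
Small codegrees raise the degrees to 2n/5, which rules out triangles. Degrees along an edge then sum
to at most n, and double counting with Cauchy–Schwarz gives the bipartite bound
(`cherryCount_le_of_relDegree_add_le`).

Otherwise some vertex lies in too few cherries; deleting it raises the excess over the bipartite
bound by at least 1. Since the excess at n₀ vertices is at most n₀³, no excess survives for n ≥ n₀ +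
n₀³ (`cherryCount_le_add_sub`). -/

namespace SimpleGraph

open scoped Classical in
/-- The number of neighbours of `u` in the finite set `S`. -/
noncomputable def relDegree {V : Type*} (G : SimpleGraph V) (S : Finset V) (u : V) : ℕ :=
  (S.filter (G.Adj u)).card

/-- Twice the number of paths on three vertices inside the finite set `S`. -/
noncomputable def cherryCount {V : Type*} (G : SimpleGraph V) (S : Finset V) : ℕ :=
  ∑ u ∈ S, G.relDegree S u * (G.relDegree S u - 1)

open scoped Classical in
/-- Twice the number of paths on three vertices inside `S` that pass through `v`. -/
noncomputable def cherryCountAt {V : Type*} (G : SimpleGraph V) (S : Finset V) (v : V) : ℕ :=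
  G.relDegree S v * (G.relDegree S v - 1) +
    ∑ u ∈ S.filter (G.Adj v), 2 * (G.relDegree S u - 1)

/-- Twice the number of paths on three vertices in the balanced complete bipartite graph
on `n` vertices. -/
def biTuranCherries (n : ℕ) : ℕ := (n / 2) * ((n + 1) / 2) * (n - 2)

/-! ### Cherry counts and the degree-sum bound -/

section
variable {V : Type*} (G : SimpleGraph V) (S : Finset V)

lemma relDegree_le_card (u : V) : G.relDegree S u ≤ S.card := by
  classical exact Finset.card_filter_le _ _

lemma cherryCount_le_card_pow : G.cherryCount S ≤ S.card ^ 3 := by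
  have h : ∀ u ∈ S, G.relDegree S u * (G.relDegree S u - 1) ≤ S.card * S.card := fun u _ =>
    Nat.mul_le_mul (G.relDegree_le_card S u) ((Nat.sub_le _ _).trans (G.relDegree_le_card S u))
  calc G.cherryCount S ≤ S.card * (S.card * S.card) := by
        simpa [cherryCount] using Finset.sum_le_card_nsmul S _ _ h
    _ = S.card ^ 3 := by ring

/-- A neighbour of `v` of degree d loses d(d-1) - (d-1)(d-2) = 2(d-1). -/
lemma cherryCount_eq_erase_add [DecidableEq V] {v : V} (hv : v ∈ S) :
    G.cherryCount S = G.cherryCount (S.erase v) + G.cherryCountAt S v := by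
  classical
  have key : ∀ u ∈ S.erase v, G.relDegree S u * (G.relDegree S u - 1) =
      G.relDegree (S.erase v) u * (G.relDegree (S.erase v) u - 1) +
        if G.Adj v u then 2 * (G.relDegree S u - 1) else 0 := by
    intro u hu
    by_cases h : G.Adj v u
    · have hd : G.relDegree S u = G.relDegree (S.erase v) u + 1 := by
        unfold relDegree
        rw [Finset.filter_erase, Finset.card_erase_add_one]
        simp [hv, h.symm]
      rw [hd, if_pos h]
      rcases G.relDegree (S.erase v) u with _ | k
      · simp
      · simp only [Nat.add_sub_cancel]; ring
    · have hd : G.relDegree S u = G.relDegree (S.erase v) u := by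
        unfold relDegree
        rw [Finset.filter_erase, Finset.erase_eq_of_notMem]
        simp only [Finset.mem_filter, not_and]
        exact fun _ h' => h h'.symm
      rw [hd, if_neg h, add_zero]
  have hf : (S.erase v).filter (G.Adj v) = S.filter (G.Adj v) := by
    ext u
    simp only [Finset.mem_filter, Finset.mem_erase]
    exact ⟨fun h => ⟨h.1.2, h.2⟩, fun h => ⟨⟨h.2.ne', h.1⟩, h.2⟩⟩
  unfold cherryCount cherryCountAt
  rw [← Finset.add_sum_erase _ _ hv, Finset.sum_congr rfl key, Finset.sum_add_distrib,
    ← Finset.sum_filter, hf]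
  ring

/-- If the degrees of any two adjacent vertices of `S` sum to at most `|S|`, there are at most as
many cherries as in the balanced complete bipartite graph. -/
lemma cherryCount_le_of_relDegree_add_le
    (h : ∀ u ∈ S, ∀ v ∈ S, G.Adj u v → G.relDegree S u + G.relDegree S v ≤ S.card) :
    G.cherryCount S ≤ biTuranCherries S.card := by
  classical
  set d := G.relDegree S with hd
  set n := S.card with hn
  set D := ∑ u ∈ S, d u with hD
  set Q := ∑ u ∈ S, d u ^ 2 with hQ
  have h1 : ∑ u ∈ S, ∑ v ∈ S, (if G.Adj u v then d u else 0) = Q := by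
    refine Finset.sum_congr rfl fun u _ => ?_
    rw [← Finset.sum_filter, Finset.sum_const, smul_eq_mul, sq]
    rfl
  have h2 : ∑ u ∈ S, ∑ v ∈ S, (if G.Adj u v then d v else 0) = Q := by
    rw [Finset.sum_comm, ← h1]
    simp only [G.adj_comm]
  have h3 : ∑ u ∈ S, ∑ v ∈ S, (if G.Adj u v then n else 0) = D * n := by
    rw [hD, Finset.sum_mul]
    refine Finset.sum_congr rfl fun u _ => ?_
    rw [← Finset.sum_filter, Finset.sum_const, smul_eq_mul]
    rfl
  -- Summing d(u) + d(v) over ordered adjacent pairs gives 2Q, and each term is at most n.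
  have h4 : 2 * Q ≤ D * n := by
    rw [two_mul]
    nth_rw 1 [← h1]
    rw [← h2, ← h3, ← Finset.sum_add_distrib]
    refine Finset.sum_le_sum fun u hu => ?_
    rw [← Finset.sum_add_distrib]
    refine Finset.sum_le_sum fun v hv => ?_
    split_ifs with huv
    · exact h u hu v hv huv
    · simp
  have h5 : D ^ 2 ≤ n * Q := sq_sum_le_card_mul_sum_sq
  -- Cauchy–Schwarz (`h5`) and `h4` give 2D² ≤ 2nQ ≤ n²D.
  have h6 : 2 * D ≤ n ^ 2 := by
    rcases Nat.eq_zero_or_pos D with h0 | h0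
    · simp [h0]
    · have : D * (2 * D) ≤ D * n ^ 2 := by nlinarith
      exact Nat.le_of_mul_le_mul_left this h0
  have h7 : G.cherryCount S + D = Q := by
    rw [hD, hQ]
    unfold cherryCount
    rw [← Finset.sum_add_distrib]
    refine Finset.sum_congr rfl fun u _ => ?_
    rw [← hd]
    rcases d u with _ | k
    · simp
    · simp only [Nat.add_sub_cancel]; ring
  have h8 : D ≤ 2 * ((n / 2) * ((n + 1) / 2)) := by
    have hpar : 2 ∣ D := by
      have := (G.induce (S : Set V)).sum_degrees_eq_twice_card_edges
      refine ⟨_, Eq.trans ?_ this⟩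
      rw [hD, ← Finset.sum_coe_sort]
      refine Finset.sum_congr rfl fun u _ => ?_
      rw [← card_neighborFinset_eq_degree]
      refine (Finset.card_bij (fun a _ => a.1) ?_ ?_ ?_).symm
      · intro a ha
        simpa using ha
      · intro a _ b _ hab
        exact Subtype.ext hab
      · intro b hb
        simp only [Finset.mem_filter] at hb
        exact ⟨⟨b, hb.1⟩, by simpa using hb.2, rfl⟩
    obtain ⟨e, he⟩ := hpar
    rcases Nat.even_or_odd' n with ⟨m, hm | hm⟩
    · have e1 : n / 2 = m := by omega
      have e2 : (n + 1) / 2 = m := by omega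
      rw [e1, e2, he]
      rw [hm, he] at h6
      nlinarith
    · have e1 : n / 2 = m := by omega
      have e2 : (n + 1) / 2 = m + 1 := by omega
      rw [e1, e2, he]
      rw [hm, he] at h6
      have : e ≤ m * (m + 1) := by
        by_contra hc
        push Not at hc
        nlinarith
      omega
  unfold biTuranCherries
  rcases Nat.lt_or_ge n 2 with hlt | hge
  · have hD0 : D = 0 := by
      have : (n / 2) * ((n + 1) / 2) = 0 := by
        have : n / 2 = 0 := by omega
        simp [this]
      omega
    have : Q = 0 := by rw [hD0] at h4; omega
    omega
  · obtain ⟨k, hk⟩ := Nat.exists_eq_add_of_le hge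
    have hk' : n - 2 = k := by omega
    rw [hk']
    rw [hk] at h4 h8 ⊢
    nlinarith [Nat.mul_le_mul_right k h8]

end

/-- The count is about n³/4, so its increment is about 3n²/4. Monotonicity makes the truncated
subtraction a true one. -/
lemma biTuranCherries_succ (n : ℕ) :
    biTuranCherries n ≤ biTuranCherries (n + 1) ∧
    3 * (n + 1) ^ 2 ≤
      4 * (biTuranCherries (n + 1) - biTuranCherries n) + 12 * (n + 1) := by
  have hkey : 3 * (n + 1) ^ 2 + 4 * biTuranCherries n ≤
        4 * biTuranCherries (n + 1) + 12 * (n + 1) ∧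
        biTuranCherries n ≤ biTuranCherries (n + 1) := by
    rcases Nat.lt_or_ge n 2 with h | h
    · interval_cases n <;> simp [biTuranCherries]
    obtain ⟨m, hm | hm⟩ := Nat.even_or_odd' n
    · obtain ⟨k, rfl⟩ : ∃ k, m = k + 1 := ⟨m - 1, by omega⟩
      unfold biTuranCherries
      have e1 : n / 2 = k + 1 := by omega
      have e2 : (n + 1) / 2 = k + 1 := by omega
      have e3 : (n + 1 + 1) / 2 = k + 2 := by omega
      have e4 : n - 2 = 2 * k := by omega
      have e5 : n + 1 - 2 = 2 * k + 1 := by omega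
      rw [e1, e2, e3, e4, e5, hm]
      constructor <;> nlinarith
    · obtain ⟨k, rfl⟩ : ∃ k, m = k + 1 := ⟨m - 1, by omega⟩
      unfold biTuranCherries
      have e1 : n / 2 = k + 1 := by omega
      have e2 : (n + 1) / 2 = k + 2 := by omega
      have e3 : (n + 1 + 1) / 2 = k + 2 := by omega
      have e4 : n - 2 = 2 * k + 1 := by omega
      have e5 : n + 1 - 2 = 2 * k + 2 := by omega
      rw [e1, e2, e3, e4, e5, hm]
      constructor <;> nlinarith
  exact ⟨hkey.2, by omega⟩

/-! ### Embedding F around one extra edge -/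

lemma colorable_two_deleteEdges_of_isColorCriticalEdge {V : Type*} {F : SimpleGraph V}
    (hF : F.chromaticNumber = 3) {e : Sym2 V} (he : F.IsColorCriticalEdge e) :
    (F.deleteEdges {e}).Colorable 2 := by
  rw [← chromaticNumber_le_iff_colorable]
  have h := he.2
  rw [hF] at h
  exact Order.le_of_lt_add_one (by simpa using h.trans_eq (by norm_num))

lemma not_colorable_two_of_chromaticNumber_eq_three {V : Type*} {F : SimpleGraph V}
    (hF : F.chromaticNumber = 3) : ¬ F.Colorable 2 := by
  rw [← chromaticNumber_le_iff_colorable, hF]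
  norm_num

/-- A 3-chromatic graph with a color-critical edge embeds in a complete bipartite graph with one
edge added inside one of the parts. -/
lemma isContained_of_complete_bipartite_add_edge {V W : Type*} [Fintype V] {F : SimpleGraph V}
    (hF : F.chromaticNumber = 3) (hcrit : ∃ e : Sym2 V, F.IsColorCriticalEdge e)
    (G : SimpleGraph W) {u v : W} (huv : G.Adj u v) {X Y : Finset W}
    (hX : Fintype.card V ≤ X.card) (hY : Fintype.card V ≤ Y.card) (hu : u ∈ Y) (hv : v ∈ Y)
    (hXY : ∀ x ∈ X, ∀ y ∈ Y, G.Adj x y) : F ⊑ G := by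
  classical
  obtain ⟨e, he⟩ := hcrit
  obtain ⟨c⟩ := colorable_two_deleteEdges_of_isColorCriticalEdge hF he
  induction e using Sym2.ind with | _ a b =>
  have hab : F.Adj a b := he.1
  have hc : ∀ {x y}, F.Adj x y → c x = c y → s(x, y) = s(a, b) := by
    intro x y hxy hxy'
    by_contra hne
    exact c.valid (v := x) (w := y) (by simpa [deleteEdges_adj, hxy] using hne) hxy'
  -- Otherwise `c` would properly 2-color F itself.
  have hcab : c a = c b := by
    by_contra hne
    refine not_colorable_two_of_chromaticNumber_eq_three hF ⟨Coloring.mk c ?_⟩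
    intro x y hxy hxy'
    have h := hc hxy hxy'
    simp only [Sym2.eq_iff] at h
    rcases h with ⟨rfl, rfl⟩ | ⟨rfl, rfl⟩
    · exact hne hxy'
    · exact hne hxy'.symm
  have hne : a ≠ b := hab.ne
  have hne' : u ≠ v := huv.ne
  have : Nonempty W := ⟨u⟩
  -- Both maps are injective without reference to the color classes, so the class sizes play no
  -- role: `ψ` serves the class mapped to `X`, `ι` the class of `a` and `b`.
  obtain ⟨ψ, hψ, hψi⟩ := (Finset.univ : Finset V).finite_toSet.exists_injOn_of_encard_le
    (t := (X : Set W)) (by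
      rw [Set.encard_coe_eq_coe_finsetCard, Set.encard_coe_eq_coe_finsetCard]
      exact_mod_cast hX)
  obtain ⟨ι, hι, hιi⟩ := ((Finset.univ.erase a).erase b).finite_toSet.exists_injOn_of_encard_le
    (t := (((Y.erase u).erase v : Finset W) : Set W)) (by
      rw [Set.encard_coe_eq_coe_finsetCard, Set.encard_coe_eq_coe_finsetCard]
      rw [Finset.card_erase_of_mem (by simp [hne.symm]), Finset.card_erase_of_mem (by simp),
        Finset.card_erase_of_mem (by simp [hne'.symm, hv]), Finset.card_erase_of_mem hu,
        Finset.card_univ]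
      exact_mod_cast Nat.sub_le_sub_right (Nat.sub_le_sub_right hY 1) 1)
  have hψX : ∀ w, ψ w ∈ X := fun w => by simpa using hψ (by simp : w ∈ _)
  have hψinj : ∀ w w', ψ w = ψ w' → w = w' := fun w w' h => hψi (by simp) (by simp) h
  have hιY : ∀ w, w ≠ a → w ≠ b → ι w ∈ Y ∧ ι w ≠ u ∧ ι w ≠ v := fun w h1 h2 => by
    have := hι (show w ∈ _ by simp [h1, h2])
    simp only [Set.mem_preimage, Finset.mem_coe, Finset.mem_erase] at this
    exact ⟨this.2.2, this.2.1, this.1⟩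
  have hιinj : ∀ w w', w ≠ a → w ≠ b → w' ≠ a → w' ≠ b → ι w = ι w' → w = w' :=
    fun w w' h1 h2 h3 h4 h => hιi (by simp [h1, h2]) (by simp [h3, h4]) h
  have hdisj : ∀ x ∈ X, x ∉ Y := fun x hx hy => (hXY x hx x hy).ne rfl
  have hglue : ∀ w w', (if w = a then u else if w = b then v else ι w) =
      (if w' = a then u else if w' = b then v else ι w') → w = w' := by
    clear hc hcab he c
    intro w w' h
    by_cases h1 : w = a <;> by_cases h2 : w = b <;> by_cases h3 : w' = a <;>
      by_cases h4 : w' = b <;> grind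
  let φ : V → W := fun w =>
    if w = a then u else if w = b then v else if c w = c a then ι w else ψ w
  have hφY : ∀ w, c w = c a → φ w ∈ Y := by
    intro w hw
    simp only [φ]
    split_ifs with h1 h2
    · exact hu
    · exact hv
    · exact (hιY w h1 h2).1
  have hφX : ∀ w, c w ≠ c a → φ w ∈ X := by
    intro w hw
    have h1 : w ≠ a := fun h => hw (congrArg c h)
    have h2 : w ≠ b := fun h => hw ((congrArg c h).trans hcab.symm)
    simp only [φ, h1, h2, hw, if_false]
    exact hψX w
  have hφinj : Function.Injective φ := by
    intro w w' h
    by_cases hw : c w = c a <;> by_cases hw' : c w' = c a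
    · simp only [φ, hw, hw', if_true] at h
      exact hglue w w' h
    · exact absurd (h ▸ hφY w hw) (hdisj _ (hφX w' hw'))
    · exact absurd (h ▸ hφY w' hw') (hdisj _ (hφX w hw))
    · have h1 : w ≠ a := fun h => hw (congrArg c h)
      have h2 : w ≠ b := fun h => hw ((congrArg c h).trans hcab.symm)
      have h3 : w' ≠ a := fun h => hw' (congrArg c h)
      have h4 : w' ≠ b := fun h => hw' ((congrArg c h).trans hcab.symm)
      simp only [φ, h1, h2, h3, h4, hw, hw', if_false] at h
      exact hψinj _ _ h
  refine ⟨⟨⟨φ, ?_⟩, hφinj⟩⟩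
  intro x y hxy
  by_cases hx : c x = c a <;> by_cases hy : c y = c a
  · have h := hc hxy (hx.trans hy.symm)
    simp only [Sym2.eq_iff] at h
    rcases h with ⟨rfl, rfl⟩ | ⟨rfl, rfl⟩
    · simpa [φ, hne.symm] using huv
    · simpa [φ, hne.symm] using huv.symm
  · exact (hXY _ (hφX y hy) _ (hφY x hx)).symm
  · exact hXY _ (hφX x hx) _ (hφY y hy)
  · refine absurd (hc hxy ?_) ?_
    · have h2 : ∀ i j k : Fin 2, i ≠ k → j ≠ k → i = j := by decide
      exact h2 _ _ _ hx hy
    · intro h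
      simp only [Sym2.eq_iff] at h
      rcases h with ⟨rfl, rfl⟩ | ⟨rfl, rfl⟩
      · exact hx rfl
      · exact hy rfl

/-! ### Local structure of F-free graphs and the induction -/

section
variable {V W : Type*} [Fintype V] {F : SimpleGraph V} {G : SimpleGraph W} {S : Finset W}

/-- If all relative degrees are at least `|S| / 4`, an edge with many common neighbours can be
completed to a complete bipartite graph with one additional edge. -/
lemma isContained_of_many_common_neighbors
    (hF : F.chromaticNumber = 3) (hcrit : ∃ e : Sym2 V, F.IsColorCriticalEdge e)
    (hS : 8 * 2 ^ (8 * Fintype.card V) * Fintype.card V ≤ S.card)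
    (hdeg : ∀ u ∈ S, S.card ≤ 4 * G.relDegree S u) {u v : W} (huv : G.Adj u v)
    {C : Finset W} (hCS : C ⊆ S) (hC : 8 * Fintype.card V ≤ C.card)
    (hCu : ∀ x ∈ C, G.Adj x u) (hCv : ∀ x ∈ C, G.Adj x v) : F ⊑ G := by
  classical
  have ht : 0 < Fintype.card V := by
    obtain ⟨e, -⟩ := hcrit
    induction e using Sym2.ind with | _ a b =>
    exact Fintype.card_pos_iff.2 ⟨a⟩
  set t := Fintype.card V with htdef
  -- Fixing |D| = 8t leaves only 2^(8t) possible traces on `D`. The degree bound gives an average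
  -- trace of at least 2t, so at least |S|/8 vertices have trace at least t, and t of them share the
  -- same one.
  obtain ⟨D, hDC, hD⟩ := Finset.exists_subset_card_eq hC
  set R := S.filter fun w => t ≤ (D.filter (G.Adj w)).card with hR
  have hlow : 2 * t * S.card ≤ ∑ w ∈ S, (D.filter (G.Adj w)).card := by
    have h1 : ∑ w ∈ S, (D.filter (G.Adj w)).card = ∑ x ∈ D, G.relDegree S x := by
      unfold relDegree
      simp only [Finset.card_filter]
      rw [Finset.sum_comm]
      simp only [G.adj_comm]
    have h2 : ∑ x ∈ D, S.card ≤ ∑ x ∈ D, 4 * G.relDegree S x :=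
      Finset.sum_le_sum fun x hx => hdeg x (hCS (hDC hx))
    rw [Finset.sum_const, smul_eq_mul, ← Finset.mul_sum, hD] at h2
    rw [h1]
    linarith
  have hup : ∑ w ∈ S, (D.filter (G.Adj w)).card ≤ 8 * t * R.card + t * S.card := by
    have h1 : ∀ w ∈ S, (D.filter (G.Adj w)).card ≤
        (if t ≤ (D.filter (G.Adj w)).card then 8 * t else 0) + t := by
      intro w _
      have := Finset.card_filter_le D (G.Adj w)
      split_ifs <;> omega
    refine (Finset.sum_le_sum h1).trans (le_of_eq ?_)
    rw [Finset.sum_add_distrib, ← Finset.sum_filter, Finset.sum_const, Finset.sum_const,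
      smul_eq_mul, smul_eq_mul]
    ring
  have hRS : S.card ≤ 8 * R.card := by
    refine le_of_mul_le_mul_left (a := t) ?_ ht
    linarith
  obtain ⟨X, hX, hXR⟩ := Finset.exists_le_card_fiber_of_mul_le_card_of_maps_to
    (s := R) (t := D.powerset) (f := fun w => D.filter (G.Adj w)) (n := t)
    (fun w _ => Finset.mem_powerset.2 (Finset.filter_subset _ _)) ⟨∅, by simp⟩ (by
      rw [Finset.card_powerset, hD]
      linarith)
  set Y := R.filter fun w => D.filter (G.Adj w) = X with hY
  obtain ⟨w, hw⟩ : Y.Nonempty := Finset.card_pos.1 (ht.trans_le hXR)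
  rw [hY, Finset.mem_filter, hR, Finset.mem_filter] at hw
  have hXD : X ⊆ C := (Finset.mem_powerset.1 hX).trans hDC
  refine isContained_of_complete_bipartite_add_edge hF hcrit G huv (X := X)
    (Y := insert u (insert v Y)) ?_ ?_ (by simp) (by simp) ?_
  · rw [← hw.2]
    exact hw.1.2
  · exact hXR.trans (Finset.card_le_card fun y hy => by simp [hy])
  · intro x hx y hy
    simp only [Finset.mem_insert] at hy
    rcases hy with rfl | rfl | hy
    · exact hCu x (hXD hx)
    · exact hCv x (hXD hx)
    · rw [hY, Finset.mem_filter] at hy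
      rw [← hy.2, Finset.mem_filter] at hx
      exact hx.2.symm

open scoped Classical in
lemma relDegree_add_relDegree_le (u v : W) :
    G.relDegree S u + G.relDegree S v ≤
      S.card + (S.filter fun x => G.Adj x u ∧ G.Adj x v).card := by
  have h := Finset.card_union_add_card_inter (S.filter (G.Adj u)) (S.filter (G.Adj v))
  have h1 : (S.filter (G.Adj u) ∪ S.filter (G.Adj v)).card ≤ S.card :=
    Finset.card_le_card (Finset.union_subset (Finset.filter_subset _ _) (Finset.filter_subset _ _))
  have h2 : S.filter (G.Adj u) ∩ S.filter (G.Adj v) =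
      S.filter fun x => G.Adj x u ∧ G.Adj x v := by
    rw [← Finset.filter_and]
    simp only [G.adj_comm]
  rw [h2] at h
  change (S.filter (G.Adj u)).card + (S.filter (G.Adj v)).card ≤ _
  omega

lemma cherryCountAt_le {v : W} {m : ℕ} (hm : ∀ u ∈ S, G.Adj v u → G.relDegree S u ≤ m) :
    G.cherryCountAt S v ≤ G.relDegree S v * (G.relDegree S v + 2 * m) := by
  classical
  have h : ∑ u ∈ S.filter (G.Adj v), 2 * (G.relDegree S u - 1) ≤ G.relDegree S v * (2 * m) := by
    refine Finset.sum_le_card_nsmul _ _ _ fun u hu => ?_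
    rw [Finset.mem_filter] at hu
    have := hm u hu.1 hu.2
    omega
  unfold cherryCountAt
  have := Nat.mul_le_mul_left (G.relDegree S v) (Nat.sub_le (G.relDegree S v) 1)
  rw [Nat.mul_add]
  omega

/-- In an `F`-free graph where each vertex lies in about as many cherries as in the balanced
complete bipartite graph, the degrees of adjacent vertices sum to at most the order. -/
lemma relDegree_add_relDegree_le_card_of_free
    (hF : F.chromaticNumber = 3) (hcrit : ∃ e : Sym2 V, F.IsColorCriticalEdge e)
    (hfree : F.Free G)
    (hS : 8 * 2 ^ (8 * Fintype.card V) * Fintype.card V + 200 * Fintype.card V + 200 ≤ S.card)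
    (hat : ∀ v ∈ S, 3 * S.card ^ 2 ≤ 4 * G.cherryCountAt S v + 12 * S.card)
    {u v : W} (hu : u ∈ S) (hv : v ∈ S) (huv : G.Adj u v) :
    G.relDegree S u + G.relDegree S v ≤ S.card := by
  classical
  set t := Fintype.card V with htdef
  set n := S.card with hn
  have hn1 : 200 * t + 200 ≤ n := by omega
  -- If d < n/4, then d(d + 2n) < (9/16)n², short of the required 3n²/4 - 3n.
  have hquarter : ∀ u ∈ S, n ≤ 4 * G.relDegree S u := by
    intro u hu
    have h1 := hat u hu
    have h2 := cherryCountAt_le (G := G) (S := S) (v := u) (m := n)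
      fun w _ _ => G.relDegree_le_card S w
    by_contra hc
    push Not at hc
    generalize G.relDegree S u = d at *
    nlinarith
  have hcodeg : ∀ {u v : W}, G.Adj u v →
      (S.filter fun x => G.Adj x u ∧ G.Adj x v).card < 8 * t := by
    intro u v huv
    by_contra hc
    push Not at hc
    exact hfree (isContained_of_many_common_neighbors hF hcrit
      ((Nat.le_add_right _ _).trans ((Nat.le_add_right _ _).trans hS)) hquarter huv
      (Finset.filter_subset _ _) hc (fun x hx => (Finset.mem_filter.1 hx).2.1)
      (fun x hx => (Finset.mem_filter.1 hx).2.2))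
  -- Neighbours now have degree at most n + 8t - d, so d < 2n/5 would allow only about (16/25)n²,
  -- still below 3n²/4.
  have hdeg : ∀ u ∈ S, 2 * n ≤ 5 * G.relDegree S u := by
    intro u hu
    have h1 := hat u hu
    have h2 := cherryCountAt_le (G := G) (S := S) (v := u)
      (m := n + 8 * t - G.relDegree S u) (fun w _ huw => by
        have := relDegree_add_relDegree_le (G := G) (S := S) u w
        have := hcodeg huw
        omega)
    have h3 := G.relDegree_le_card S u
    obtain ⟨m, hm⟩ : ∃ m, n + 8 * t = G.relDegree S u + m := Nat.exists_eq_add_of_le (by omega)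
    rw [hm, Nat.add_sub_cancel_left] at h2
    by_contra hc
    push Not at hc
    generalize G.relDegree S u = d at *
    generalize G.cherryCountAt S u = c at *
    have h4 : d * (d + 2 * m) + d * d = 2 * d * (n + 8 * t) := by rw [hm]; ring
    have h5 : 25 * (d * (d + 2 * m)) ≤ 16 * n ^ 2 + 160 * t * n := by
      zify at *
      nlinarith [mul_nonneg (sub_nonneg.2 hc.le) (sub_nonneg.2 hc.le)]
    nlinarith
  have hempty : (S.filter fun x => G.Adj x u ∧ G.Adj x v) = ∅ := by
    rw [Finset.eq_empty_iff_forall_notMem]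
    intro x hx
    rw [Finset.mem_filter] at hx
    obtain ⟨hxS, hxu, hxv⟩ := hx
    -- In a triangle, three degrees of at least 2n/5 would sum to at most n plus three codegrees,
    -- that is, less than n + 24t.
    have key : (S.filter (G.Adj u)).card + (S.filter (G.Adj v)).card + (S.filter (G.Adj x)).card ≤
        n + (S.filter fun y => G.Adj y u ∧ G.Adj y v).card +
          (S.filter fun y => G.Adj y x ∧ G.Adj y u).card +
          (S.filter fun y => G.Adj y x ∧ G.Adj y v).card := by
      rw [hn, Finset.card_eq_sum_ones S]
      simp only [Finset.card_filter, ← Finset.sum_add_distrib]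
      refine Finset.sum_le_sum fun y _ => ?_
      simp only [G.adj_comm y]
      by_cases h1 : G.Adj u y <;> by_cases h2 : G.Adj v y <;> by_cases h3 : G.Adj x y <;>
        simp [h1, h2, h3]
    have h1 := hdeg u hu
    have h2 := hdeg v hv
    have h3 := hdeg x hxS
    have h4 := hcodeg huv
    have h5 := hcodeg hxu
    have h6 := hcodeg hxv
    unfold relDegree at h1 h2 h3
    omega
  have := relDegree_add_relDegree_le (G := G) (S := S) u v
  rw [hempty, Finset.card_empty] at this
  omega

/-- In an `F`-free graph, the excess of the number of cherries over the balanced complete bipartite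
graph decreases with each vertex beyond a threshold depending on `F` only. -/
lemma cherryCount_le_add_sub
    (hF : F.chromaticNumber = 3) (hcrit : ∃ e : Sym2 V, F.IsColorCriticalEdge e)
    (hfree : F.Free G) {n₀ : ℕ}
    (hn₀ : 8 * 2 ^ (8 * Fintype.card V) * Fintype.card V + 200 * Fintype.card V + 200 ≤ n₀)
    (k : ℕ) (S : Finset W) (hS : S.card = n₀ + k) :
    G.cherryCount S ≤ biTuranCherries S.card + (n₀ ^ 3 - k) := by
  classical
  induction k generalizing S with
  | zero =>
    have := G.cherryCount_le_card_pow S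
    rw [hS, Nat.add_zero] at this ⊢
    omega
  | succ k ih =>
    by_contra hc
    push Not at hc
    obtain ⟨hmono, hstep⟩ := biTuranCherries_succ (n₀ + k)
    have hS' : S.card = n₀ + k + 1 := by omega
    -- The allowed excess drops by at most 1 from `k` to `k + 1`, and `hc` is strict, so each vertex
    -- carries at least the full increment.
    have hat : ∀ v ∈ S, biTuranCherries (n₀ + k + 1) - biTuranCherries (n₀ + k) ≤
        G.cherryCountAt S v := by
      intro v hv
      have h1 := G.cherryCount_eq_erase_add S hv
      have hcard : (S.erase v).card = n₀ + k := by
        rw [Finset.card_erase_of_mem hv]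
        omega
      have h2 := ih (S.erase v) hcard
      rw [hcard] at h2
      rw [hS'] at hc
      omega
    have h := G.cherryCount_le_of_relDegree_add_le S fun u hu v hv huv =>
      relDegree_add_relDegree_le_card_of_free hF hcrit hfree (by omega) (fun v hv => by
        have := hat v hv
        rw [hS']
        omega) hu hv huv
    omega

end

/-! ### From cherries to copies of the path -/

open scoped Classical in
lemma card_copy_pathGraph_three {V : Type*} [Fintype V] (G : SimpleGraph V) :
    Fintype.card ((pathGraph 3).Copy G) = G.cherryCount Finset.univ := by
  have h : G.cherryCount Finset.univ =
      (Finset.univ.sigma fun v => (Finset.univ.filter (G.Adj v)).offDiag).card := by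
    rw [Finset.card_sigma]
    refine Finset.sum_congr rfl fun v _ => ?_
    rw [Finset.offDiag_card, Nat.mul_sub_one]
    rfl
  rw [h, ← Finset.card_univ]
  refine Finset.card_bij (fun f _ => ⟨f 1, (f 0, f 2)⟩) ?_ ?_ ?_
  · intro f _
    simp only [Finset.mem_sigma, Finset.mem_univ, true_and, Finset.mem_offDiag, Finset.mem_filter]
    refine ⟨f.toHom.map_adj ?_, f.toHom.map_adj ?_, fun h => ?_⟩
    · simp [pathGraph_adj]
    · simp [pathGraph_adj]
    · exact absurd (f.injective h) (by decide)
  · intro f _ g _ h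
    simp only [Sigma.mk.injEq, heq_eq_eq, Prod.mk.injEq] at h
    ext i
    fin_cases i
    · exact h.2.1
    · exact h.1
    · exact h.2.2
  · rintro ⟨v, a, b⟩ h
    simp only [Finset.mem_sigma, Finset.mem_univ, true_and, Finset.mem_offDiag,
      Finset.mem_filter] at h
    obtain ⟨ha, hb, hab⟩ := h
    refine ⟨⟨⟨![a, v, b], ?_⟩, ?_⟩, Finset.mem_univ _, rfl⟩
    · intro i j hij
      fin_cases i <;> fin_cases j <;> simp_all [pathGraph_adj, G.adj_comm]
    · intro i j hij
      have := ha.ne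
      have := hb.ne
      fin_cases i <;> fin_cases j <;> simp_all

/-- Reversal of the path on three vertices. -/
def pathGraphThreeRev : (pathGraph 3).Copy (pathGraph 3) :=
  ⟨⟨Fin.rev, by intro i j; revert i j; simp only [pathGraph_adj]; decide⟩, Fin.rev_injective⟩

/-- The path has just two automorphisms, so each unlabelled copy comes from exactly two labelled
ones. -/
lemma copy_pathGraph_three_toSubgraph_eq_iff {V : Type*} {G : SimpleGraph V}
    (f g : (pathGraph 3).Copy G) :
    g.toSubgraph = f.toSubgraph ↔ g = f ∨ g = f.comp pathGraphThreeRev := by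
  have hadj : ∀ (h : (pathGraph 3).Copy G) x y, h.toSubgraph.Adj x y ↔
      (x = h 0 ∧ y = h 1) ∨ (x = h 1 ∧ y = h 0) ∨ (x = h 1 ∧ y = h 2) ∨ (x = h 2 ∧ y = h 1) := by
    intro h x y
    simp only [Copy.toSubgraph, Subgraph.map_adj, Relation.Map, Subgraph.top_adj, pathGraph_adj,
      Copy.toHom_apply]
    constructor
    · rintro ⟨i, j, hij, rfl, rfl⟩
      fin_cases i <;> fin_cases j <;> simp_all
    · rintro (⟨rfl, rfl⟩ | ⟨rfl, rfl⟩ | ⟨rfl, rfl⟩ | ⟨rfl, rfl⟩)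
      · exact ⟨0, 1, by simp, rfl, rfl⟩
      · exact ⟨1, 0, by simp, rfl, rfl⟩
      · exact ⟨1, 2, by simp, rfl, rfl⟩
      · exact ⟨2, 1, by simp, rfl, rfl⟩
  have hverts : ∀ (h : (pathGraph 3).Copy G) x, x ∈ h.toSubgraph.verts ↔
      x = h 0 ∨ x = h 1 ∨ x = h 2 := by
    intro h x
    simp only [Copy.toSubgraph, Subgraph.map_verts, Subgraph.verts_top, Set.image_univ,
      Set.mem_range, Copy.toHom_apply]
    constructor
    · rintro ⟨i, rfl⟩
      fin_cases i <;> simp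
    · rintro (rfl | rfl | rfl) <;> exact ⟨_, rfl⟩
  have hr : ∀ i, f.comp pathGraphThreeRev i = f i.rev := fun i => rfl
  constructor
  · intro h
    have h1 : f.toSubgraph.Adj (g 0) (g 1) := by rw [← h, hadj]; simp
    have h2 : f.toSubgraph.Adj (g 1) (g 2) := by rw [← h, hadj]; simp
    have h3 : g 0 ≠ g 2 := fun h => absurd (g.injective h) (by decide)
    have f1 : f 0 ≠ f 2 := fun h => absurd (f.injective h) (by decide)
    have f2 : f 0 ≠ f 1 := fun h => absurd (f.injective h) (by decide)
    have f3 : f 1 ≠ f 2 := fun h => absurd (f.injective h) (by decide)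
    rw [hadj] at h1 h2
    have : (g 0 = f 0 ∧ g 1 = f 1 ∧ g 2 = f 2) ∨ (g 0 = f 2 ∧ g 1 = f 1 ∧ g 2 = f 0) := by
      clear hadj hverts h hr
      generalize g 0 = g0, g 1 = g1, g 2 = g2, f 0 = f0, f 1 = f1, f 2 = f2 at *
      grind
    rcases this with h | h
    · left
      ext i
      fin_cases i
      exacts [h.1, h.2.1, h.2.2]
    · right
      ext i
      rw [hr]
      fin_cases i
      exacts [h.1, h.2.1, h.2.2]
  · rintro (rfl | rfl)
    · rfl
    · ext x y
      · rw [hverts, hverts, hr, hr, hr]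
        change (x = f 2 ∨ x = f 1 ∨ x = f 0) ↔ _
        tauto
      · rw [hadj, hadj, hr, hr, hr]
        change (x = f 2 ∧ y = f 1) ∨ (x = f 1 ∧ y = f 2) ∨ (x = f 1 ∧ y = f 0) ∨
          (x = f 0 ∧ y = f 1) ↔ _
        tauto

lemma two_mul_copyCount_pathGraph_three {V : Type*} [Fintype V] (G : SimpleGraph V) :
    2 * G.copyCount (pathGraph 3) = G.cherryCount Finset.univ := by
  classical
  rw [copyCount_eq_card_image_copyToSubgraph, ← card_copy_pathGraph_three, ← Finset.card_univ,
    Finset.card_eq_sum_card_image Copy.toSubgraph, mul_comm]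
  refine (Finset.sum_const_nat ?_).symm
  intro K hK
  obtain ⟨f, -, rfl⟩ := Finset.mem_image.1 hK
  rw [Finset.card_eq_two]
  refine ⟨f, f.comp pathGraphThreeRev, fun h => ?_, ?_⟩
  · have h0 : f 0 = f 2 := congrArg (fun k : (pathGraph 3).Copy G => k 0) h
    exact absurd (f.injective h0) (by decide)
  · ext g
    simp [copy_pathGraph_three_toSubgraph_eq_iff]

/-! ### The Turán graph attains the bound -/

lemma sum_range_ite_even (α β n : ℕ) :
    ∑ i ∈ Finset.range n, (if i % 2 = 0 then α else β) = (n + 1) / 2 * α + n / 2 * β := by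
  induction n with
  | zero => simp
  | succ n ih =>
    rw [Finset.sum_range_succ, ih]
    rcases Nat.mod_two_eq_zero_or_one n with h | h
    · rw [if_pos h, show (n + 1 + 1) / 2 = (n + 1) / 2 + 1 by omega,
        show (n + 1) / 2 = n / 2 by omega]
      ring
    · rw [if_neg (by omega), show (n + 1 + 1) / 2 = (n + 1) / 2 by omega,
        show (n + 1) / 2 = n / 2 + 1 by omega]
      ring

lemma cherryCount_turanGraph_two (n : ℕ) :
    (turanGraph n 2).cherryCount Finset.univ = biTuranCherries n := by
  classical
  have hdeg : ∀ v : Fin n, (turanGraph n 2).relDegree Finset.univ v =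
      if (v : ℕ) % 2 = 0 then n / 2 else (n + 1) / 2 := by
    intro v
    unfold relDegree
    rw [Finset.card_filter]
    simp only [turanGraph_adj]
    rw [Fin.sum_univ_eq_sum_range (fun i => if (v : ℕ) % 2 ≠ i % 2 then 1 else 0) n]
    split_ifs with h
    · rw [h, ← Nat.zero_add (n / 2)]
      convert sum_range_ite_even 0 1 n using 1
      · refine Finset.sum_congr rfl fun i _ => ?_
        split_ifs <;> omega
      · simp
    · convert sum_range_ite_even 1 0 n using 1
      · refine Finset.sum_congr rfl fun i _ => ?_
        split_ifs <;> omega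
      · simp
  unfold cherryCount
  simp only [hdeg]
  rw [Fin.sum_univ_eq_sum_range (fun i => (if i % 2 = 0 then n / 2 else (n + 1) / 2) *
    ((if i % 2 = 0 then n / 2 else (n + 1) / 2) - 1)) n]
  have := sum_range_ite_even (n / 2 * (n / 2 - 1)) ((n + 1) / 2 * ((n + 1) / 2 - 1)) n
  convert this using 1
  · refine Finset.sum_congr rfl fun i _ => ?_
    split_ifs <;> rfl
  · unfold biTuranCherries
    rcases Nat.lt_or_ge n 2 with h | h
    · interval_cases n <;> simp
    · obtain ⟨a, ha⟩ : ∃ a, n / 2 = a + 1 := ⟨n / 2 - 1, by omega⟩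
      obtain ⟨b, hb⟩ : ∃ b, (n + 1) / 2 = b + 1 := ⟨(n + 1) / 2 - 1, by omega⟩
      have hn : n - 2 = a + b := by omega
      rw [ha, hb, hn]
      simp only [Nat.add_sub_cancel]
      ring

lemma turanGraph_two_colorable (n : ℕ) : (turanGraph n 2).Colorable 2 := by
  refine ⟨Coloring.mk (fun v => (⟨v % 2, Nat.mod_lt _ two_pos⟩ : Fin 2)) ?_⟩
  intro v w h
  simpa [turanGraph_adj, Fin.ext_iff] using h

lemma free_of_colorable_two {V W : Type*} {F : SimpleGraph V} {G : SimpleGraph W}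
    (hF : F.chromaticNumber = 3) (hG : G.Colorable 2) : F.Free G := by
  rintro ⟨f⟩
  exact not_colorable_two_of_chromaticNumber_eq_three hF (hG.of_hom f.toHom)

end SimpleGraph

theorem theorem1 {V : Type*} [Finite V] (F : SimpleGraph V)
    (hF : F.chromaticNumber = 3) (hcrit : ∃ e : Sym2 V, F.IsColorCriticalEdge e) :
    SimpleGraph.IsTuranGood (SimpleGraph.pathGraph 3) F := by
  classical
  cases nonempty_fintype V
  refine ⟨SimpleGraph.free_of_colorable_two hF
    (by simpa using (SimpleGraph.pathGraph.bicoloring 3).colorable), 2, by norm_num,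
    by rw [hF]; norm_num, ?_⟩
  set n₀ := 8 * 2 ^ (8 * Fintype.card V) * Fintype.card V + 200 * Fintype.card V + 200 with hn₀
  filter_upwards [eventually_ge_atTop (n₀ + n₀ ^ 3)] with n hn
  refine le_antisymm (Finset.sup_le fun G hG => ?_) ?_
  · rw [Finset.mem_filter] at hG
    obtain ⟨k, hk⟩ : ∃ k, n = n₀ + k := Nat.exists_eq_add_of_le (by omega)
    have h := SimpleGraph.cherryCount_le_add_sub hF hcrit hG.2 hn₀.ge k Finset.univ
      (by simpa using hk)
    have hk' : n₀ ^ 3 - k = 0 := by omega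
    rw [hk', add_zero, Finset.card_univ, Fintype.card_fin,
      ← SimpleGraph.cherryCount_turanGraph_two,
      ← SimpleGraph.two_mul_copyCount_pathGraph_three,
      ← SimpleGraph.two_mul_copyCount_pathGraph_three] at h
    omega
  · unfold SimpleGraph.genExtremalNumber
    exact Finset.le_sup (f := fun G : SimpleGraph (Fin n) =>
      G.copyCount (SimpleGraph.pathGraph 3)) (Finset.mem_filter.2 ⟨Finset.mem_univ _,
        SimpleGraph.free_of_colorable_two hF (SimpleGraph.turanGraph_two_colorable n)⟩)
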